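/- Let $0<p<1$, $q=1-p$ and $\kappa=1/q$. Let $G(n,p)$ be the random graph on $n$ labelled vertices in which every possible edge is present independently with probability $p$. Consider the naive exhaustive search for a maximum independent set: on a (remaining) graph with at least two vertices it picks a vertex $v$ by a fixed rule that depends only on the set of remaining vertices, and calls itself on the graph without $v$ and on the graph without $v$ and all neighbours of $v$. Its cost $X$ (the number of recursive calls) is $0$ on the empty graph, $1$ on a graph with one vertex, and otherwise the sum of the costs of the two recursive calls. Let $\mu_n$ be the expected cost on $G(n,p)$. Then, as $n\to\infty$, $$\mu_n=\frac{G\left(\log_\kappa\frac{n}{\log_\kappa n}\right)}{\sqrt{2\pi}}\cdot\frac{n^{1/\log\kappa+1/2}}{\log_\kappa n}\,\exp\left(\frac{\left(\log\frac{n}{\log_\kappa n}\right)^2}{2\log\kappa}\right)\left(1+O\left(\frac{(\log\log n)^2}{\log n}\right)\right),$$ where the error term does not depend on the rule for picking $v$, and where, $\{u\}$ being the fractional part of $u$, $$G(u)=q^{(\{u\}^2-\{u\})/2}\sum_{j\in\mathbb{Z}}\frac{q^{j(j+1)/2}}{1+q^{j-\{u\}}}\,q^{-j\{u\}}.$$ The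 series converges for every real $u$, and $G$ is a bounded, positive, $1$-periodic function of $u$. -/

import Mathlib

namespace MISSearch

/-- A branching rule: it names, for every non-empty set `S` of remaining vertices, the vertex
of `S` on which the search branches.  It sees the vertices only, not the edges of the graph. -/
abbrev BranchingRule (V : Type*) := ∀ S : Finset V, S.Nonempty → {v : V // v ∈ S}

open Classical in
/-- The exhaustive search for a maximum independent set in the subgraph of `G` induced on `S`.
The first component of the value is the independence number that the search returns, the second
one is the cost `X`.  If `S` has at least two vertices, the search picks a vertex `v` of `S` and
branches: either `v` is left out, and the search goes on in `S \ {v}`, or `v` is taken, and it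
goes on in `S \ N*(v)`, where `N*(v)` consists of `v` and its neighbours; the two costs add up.
On an empty set the search returns `0` at cost `0`, on a single vertex it returns `1` at
cost `1`. -/
noncomputable def search {V : Type*} [DecidableEq V] (pick : BranchingRule V)
    (G : SimpleGraph V) (S : Finset V) : ℕ × ℕ :=
  if h : 2 ≤ S.card then
    let v := pick S (Finset.card_pos.mp (by omega))
    let out := search pick G (S.erase v.1)
    let taken := search pick G ((S.erase v.1).filter fun w => ¬ G.Adj v.1 w)
    (max out.1 (1 + taken.1), out.2 + taken.2)
  else (S.card, S.card)
termination_by S.card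
decreasing_by
  · exact Finset.card_erase_lt_of_mem v.2
  · exact (Finset.card_le_card (Finset.filter_subset _ _)).trans_lt
      (Finset.card_erase_lt_of_mem v.2)

/-- The cost of the exhaustive search on the whole graph `G`. -/
noncomputable def cost {V : Type*} [Fintype V] [DecidableEq V] (pick : BranchingRule V)
    (G : SimpleGraph V) : ℕ :=
  (search pick G Finset.univ).2

/-- The expected cost of the exhaustive search on the random graph `G(n, p)`. -/
noncomputable def expectedCost (p : unitInterval) (n : ℕ) (pick : BranchingRule (Fin n)) : ℝ :=
  ∫ G, (cost pick G : ℝ) ∂(SimpleGraph.binomialRandom (Fin n) p)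

/-- The `j`-th term of the bilateral series in the definition of `periodicG`. -/
noncomputable def termG (q u : ℝ) (j : ℤ) : ℝ :=
  q ^ ((j : ℝ) * ((j : ℝ) + 1) / 2) / (1 + q ^ ((j : ℝ) - Int.fract u))
    * q ^ (-(j : ℝ) * Int.fract u)

/-- The function `G(u)`. -/
noncomputable def periodicG (q u : ℝ) : ℝ :=
  q ^ ((Int.fract u ^ 2 - Int.fract u) / 2) * ∑' j : ℤ, termG q u j

/-- The main term of the asymptotic formula, with `κ = 1 / q`. -/
noncomputable def mainTerm (q x : ℝ) : ℝ :=
  let κ : ℝ := 1 / q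
  periodicG q (Real.logb κ (x / Real.logb κ x)) / Real.sqrt (2 * Real.pi)
    * (x ^ (1 / Real.log κ + 1 / 2) / Real.logb κ x)
    * Real.exp (Real.log (x / Real.logb κ x) ^ 2 / (2 * Real.log κ))

end MISSearch

/-! The rule sees no edges, so the edges at the picked vertex are independent of those among the
remaining vertices. Hence, whatever the rule, the expected costs satisfy `μ (n + 1) = μ n + E (μ K)`
for `n ≥ 1`, with `K`, the number of non-neighbours, binomial with parameters `n` and `q`
(`bernoulliSum_search`).

The recurrence has an explicit solution `meanCost`: the sum over `j` of `q ^ (j + 1).choose 2` times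
the sum over `ℓ` of `(1 - q ^ j) ^ ℓ * (n - 1 - ℓ).choose j`. It works because averaging over `K`
carries the `j`-th inner sum to the increment of the next one (`binomialMean_dampedChooseSum`).
Consecutive summands have ratio about `(1 - q ^ j) * (1 - j / n)`, so the inner sum is about `n ^ j
/ j! * (n / (j + q ^ j * n))`.

Let `L = log κ`, `N = log_κ n` and `u = log_κ (n / N) = N - log N / L`. Substituting `n = N * κ ^
u`, the approximate `j`-th term factors exactly (`pow_mul_eq_growthFactor_mul`) into a quantity free
of `j`, the Gaussian-type weight `profile q (j - u)`, and a corrected Poisson weight of mean `N`,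
scaled to be near 1 for `j` near `N`. The profiles over all integers sum to `periodicG q u`.

The relative error at `j` is of order `(1 + (j - N) ^ 2) / N` near `N`, and `j - N = (j - u) - log N
/ L`. The decay of the profile absorbs powers of `j - u`; what remains is `(log N) ^ 2 / N`, of
order `(log log n) ^ 2 / log n`. Since `periodicG` is bounded away from 0, this is a relative error.
-/

namespace MISSearch

/-! ### Expectations over random subsets -/

/-- The expectation of `F` of a random subset of `D` that contains every element of `D`
independently with probability `p`, where `q = 1 - p`. -/
noncomputable def bernoulliSum {α : Type*} [DecidableEq α] (p q : ℝ) (D : Finset α)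
    (F : Finset α → ℝ) : ℝ :=
  ∑ E ∈ D.powerset, p ^ E.card * q ^ (D.card - E.card) * F E

section Bernoulli

variable {α : Type*} [DecidableEq α] (p q : ℝ)

lemma bernoulliSum_empty (F : Finset α → ℝ) : bernoulliSum p q ∅ F = F ∅ := by
  simp [bernoulliSum]

lemma bernoulliSum_congr {D : Finset α} {F F' : Finset α → ℝ} (h : ∀ E ⊆ D, F E = F' E) :
    bernoulliSum p q D F = bernoulliSum p q D F' :=
  Finset.sum_congr rfl fun E hE => by rw [h E (Finset.mem_powerset.mp hE)]

lemma bernoulliSum_add (D : Finset α) (F F' : Finset α → ℝ) :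
    bernoulliSum p q D (fun E => F E + F' E) =
      bernoulliSum p q D F + bernoulliSum p q D F' := by
  simp [bernoulliSum, mul_add, Finset.sum_add_distrib]

lemma bernoulliSum_comm {β : Type*} [DecidableEq β] (D : Finset α) (D' : Finset β)
    (F : Finset α → Finset β → ℝ) :
    bernoulliSum p q D (fun A => bernoulliSum p q D' (F A)) =
      bernoulliSum p q D' (fun B => bernoulliSum p q D (fun A => F A B)) := by
  simp only [bernoulliSum, Finset.mul_sum]
  rw [Finset.sum_comm]
  refine Finset.sum_congr rfl fun B _ => Finset.sum_congr rfl fun A _ => by ring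

lemma bernoulliSum_insert {e : α} {D : Finset α} (he : e ∉ D) (F : Finset α → ℝ) :
    bernoulliSum p q (insert e D) F =
      q * bernoulliSum p q D F + p * bernoulliSum p q D (fun E => F (insert e E)) := by
  simp only [bernoulliSum]
  rw [Finset.sum_powerset_insert he, Finset.mul_sum, Finset.mul_sum]
  congr 1 <;> refine Finset.sum_congr rfl fun E hE => ?_
  · have := Finset.card_le_card (Finset.mem_powerset.mp hE)
    rw [Finset.card_insert_of_notMem he, Nat.succ_sub this, pow_succ]
    ring
  · have h' : e ∉ E := fun h => he (Finset.mem_powerset.mp hE h)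
    rw [Finset.card_insert_of_notMem he, Finset.card_insert_of_notMem h', Nat.add_sub_add_right,
      pow_succ]
    ring

lemma bernoulliSum_const (hpq : p + q = 1) (D : Finset α) (c : ℝ) :
    bernoulliSum p q D (fun _ => c) = c := by
  induction D using Finset.induction_on with
  | empty => exact bernoulliSum_empty p q _
  | insert e D he ih => rw [bernoulliSum_insert p q he, ih, ← add_mul, add_comm q, hpq, one_mul]

lemma bernoulliSum_union {D D' : Finset α} (h : Disjoint D D') (F : Finset α → ℝ) :
    bernoulliSum p q (D ∪ D') F =
      bernoulliSum p q D (fun A => bernoulliSum p q D' (fun B => F (A ∪ B))) := by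
  induction D' using Finset.induction_on generalizing F with
  | empty => simp [bernoulliSum_empty]
  | insert e D' he ih =>
    rw [Finset.disjoint_insert_right] at h
    have h1 : e ∉ D ∪ D' := by simp [h.1, he]
    rw [Finset.union_insert, bernoulliSum_insert p q h1, ih h.2, ih h.2]
    simp only [bernoulliSum_insert p q he, Finset.union_insert]
    simp only [bernoulliSum, mul_add, Finset.sum_add_distrib, Finset.mul_sum]
    congr 1 <;> refine Finset.sum_congr rfl fun A _ => Finset.sum_congr rfl fun B _ => by ring

lemma bernoulliSum_card (D : Finset α) (f : ℕ → ℝ) :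
    bernoulliSum p q D (fun E => f (D.card - E.card)) =
      ∑ k ∈ Finset.range (D.card + 1), (D.card.choose k : ℝ) * q ^ k * p ^ (D.card - k) * f k := by
  simp only [bernoulliSum]
  rw [Finset.sum_powerset_apply_card
    (fun m => p ^ m * q ^ (D.card - m) * f (D.card - m)) (x := D),
    ← Finset.sum_range_reflect]
  refine Finset.sum_congr rfl fun k hk => ?_
  have hk' : k ≤ D.card := Nat.lt_succ_iff.mp (Finset.mem_range.mp hk)
  have h1 : D.card + 1 - 1 - k = D.card - k := by omega
  rw [h1, Nat.sub_sub_self hk', Nat.choose_symm hk', nsmul_eq_mul]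
  ring

end Bernoulli

/-! ### The recurrence for the expected cost -/

section Search

variable {V : Type*} [DecidableEq V]

open Classical in
lemma search_of_two_le (pick : BranchingRule V) (G : SimpleGraph V) {S : Finset V}
    (h : 2 ≤ S.card) (hS : S.Nonempty) :
    (search pick G S).2 = (search pick G (S.erase (pick S hS).1)).2 +
      (search pick G ((S.erase (pick S hS).1).filter fun w => ¬ G.Adj (pick S hS).1 w)).2 := by
  rw [search, dif_pos h]

lemma search_of_card_lt_two (pick : BranchingRule V) (G : SimpleGraph V) {S : Finset V}
    (h : S.card < 2) : (search pick G S).2 = S.card := by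
  rw [search, dif_neg (by omega)]

/-- The choices of `pick` depend on vertex sets alone, and every adjacency test is between vertices
of the current set. This locality is the source of the independence used below. -/
lemma search_congr (pick : BranchingRule V) (G G' : SimpleGraph V) (S : Finset V)
    (h : ∀ a ∈ S, ∀ b ∈ S, G.Adj a b ↔ G'.Adj a b) :
    (search pick G S).2 = (search pick G' S).2 := by
  classical
  induction hn : S.card using Nat.strong_induction_on generalizing S with
  | _ n ih =>
    by_cases h2 : 2 ≤ S.card
    · have hS : S.Nonempty := Finset.card_pos.mp (by omega)
      rw [search_of_two_le pick G h2 hS, search_of_two_le pick G' h2 hS]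
      set v := pick S hS
      have hlt := Finset.card_erase_lt_of_mem v.2
      have hsub : S.erase v.1 ⊆ S := Finset.erase_subset _ _
      have hfil : (S.erase v.1).filter (fun w => ¬ G.Adj v.1 w) =
          (S.erase v.1).filter (fun w => ¬ G'.Adj v.1 w) :=
        Finset.filter_congr fun w hw => by rw [h _ v.2 _ (hsub hw)]
      have hsub' : (S.erase v.1).filter (fun w => ¬ G'.Adj v.1 w) ⊆ S.erase v.1 :=
        Finset.filter_subset _ _
      rw [hfil, ih _ (by omega) _ (fun a ha b hb => h a (hsub ha) b (hsub hb)) rfl,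
        ih _ (by have := Finset.card_le_card hsub'; omega) _
          (fun a ha b hb => h a (hsub (hsub' ha)) b (hsub (hsub' hb))) rfl]
    · rw [search_of_card_lt_two pick G (by omega), search_of_card_lt_two pick G' (by omega)]

/-- The pairs of distinct elements of `V`. -/
def allEdges (V : Type*) [Fintype V] [DecidableEq V] : Finset (Sym2 V) :=
  Finset.univ.filter fun e => ¬ e.IsDiag

/-- A real sequence with the recurrence of the expected costs. -/
structure IsCostSequence (p q : ℝ) (μ : ℕ → ℝ) : Prop where
  zero : μ 0 = 0
  one : μ 1 = 1
  succ : ∀ n, 1 ≤ n → μ (n + 1) = μ n +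
    ∑ k ∈ Finset.range (n + 1), (n.choose k : ℝ) * q ^ k * p ^ (n - k) * μ k

variable [Fintype V]

/-- Strong induction on the size of `S`. The edges from the picked vertex `v` to the rest of `S`
form a star, which decides the second call's vertex set; the remaining edges decide the costs of
both calls. -/
lemma bernoulliSum_search {p q : ℝ} (hpq : p + q = 1) {μ : ℕ → ℝ} (hμ : IsCostSequence p q μ)
    (pick : BranchingRule V) (S : Finset V) :
    bernoulliSum p q (allEdges V)
      (fun E => ((search pick (SimpleGraph.fromEdgeSet (E : Set (Sym2 V))) S).2 : ℝ)) =
      μ S.card := by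
  classical
  induction hn : S.card using Nat.strong_induction_on generalizing S with
  | _ n ih =>
    by_cases h2 : 2 ≤ S.card
    · have hS : S.Nonempty := Finset.card_pos.mp (by omega)
      set v := pick S hS with hv
      have hlt := Finset.card_erase_lt_of_mem v.2
      have hcard := Finset.card_erase_of_mem v.2
      simp only [search_of_two_le pick _ h2 hS, Nat.cast_add]
      rw [bernoulliSum_add, ← hv, ih _ (by omega) _ rfl]
      obtain ⟨m, rfl⟩ : ∃ m, n = m + 1 := ⟨n - 1, by omega⟩
      have hm : (S.erase v.1).card = m := by omega
      rw [hm, hμ.succ m (by omega)]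
      congr 1
      set W := S.erase v.1 with hW
      set D' : Finset (Sym2 V) := W.image (fun w => s(v.1, w)) with hD'
      have hD'card : D'.card = m := by
        rw [hD', Finset.card_image_of_injective _ (fun a b h => Sym2.congr_right.mp h), hm]
      have hsub : D' ⊆ allEdges V := by
        intro e he
        obtain ⟨w, hw, rfl⟩ := Finset.mem_image.mp he
        simp only [allEdges, Finset.mem_filter, Finset.mem_univ, true_and, Sym2.mk_isDiag_iff]
        exact fun h => (Finset.ne_of_mem_erase hw) h.symm
      have hunion : (allEdges V \ D') ∪ D' = allEdges V := Finset.sdiff_union_of_subset hsub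
      have hdisj : Disjoint (allEdges V \ D') D' := Finset.sdiff_disjoint
      have hloc : ∀ U ⊆ W, ∀ A, ∀ B ⊆ D',
          (search pick (SimpleGraph.fromEdgeSet ((A ∪ B : Finset (Sym2 V)) : Set (Sym2 V))) U).2 =
          (search pick (SimpleGraph.fromEdgeSet (A : Set (Sym2 V))) U).2 := by
        intro U hU A B hB
        refine search_congr pick _ _ U fun a ha b hb => ?_
        have ha' : a ≠ v.1 := Finset.ne_of_mem_erase (hU ha)
        have hb' : b ≠ v.1 := Finset.ne_of_mem_erase (hU hb)
        have hnot : s(a, b) ∉ B := by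
          intro h
          obtain ⟨w, _, hw⟩ := Finset.mem_image.mp (hB h)
          rw [Sym2.eq_iff] at hw
          rcases hw with hw | hw
          · exact ha' hw.1.symm
          · exact hb' hw.1.symm
        simp [SimpleGraph.fromEdgeSet_adj, hnot]
      have hfil : ∀ A ⊆ allEdges V \ D', ∀ B : Finset (Sym2 V), ∀ [DecidablePred fun w =>
          ¬ (SimpleGraph.fromEdgeSet ((A ∪ B : Finset (Sym2 V)) : Set (Sym2 V))).Adj v.1 w],
          W.filter (fun w => ¬ (SimpleGraph.fromEdgeSet
            ((A ∪ B : Finset (Sym2 V)) : Set (Sym2 V))).Adj v.1 w) =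
          W.filter (fun w => s(v.1, w) ∉ B) := by
        intro A hA B _
        refine Finset.filter_congr fun w hw => ?_
        have h1 : s(v.1, w) ∉ A := fun h =>
          (Finset.mem_sdiff.mp (hA h)).2 (Finset.mem_image_of_mem _ hw)
        have h2 : v.1 ≠ w := (Finset.ne_of_mem_erase hw).symm
        simp [SimpleGraph.fromEdgeSet_adj, h1, h2]
      have hcnt : ∀ B ⊆ D', (W.filter (fun w => s(v.1, w) ∉ B)).card = D'.card - B.card := by
        intro B hB
        rw [← Finset.card_sdiff_of_subset hB]
        refine Finset.card_bij (fun w _ => s(v.1, w)) ?_ ?_ ?_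
        · intro w hw
          rw [Finset.mem_filter] at hw
          exact Finset.mem_sdiff.mpr ⟨Finset.mem_image_of_mem _ hw.1, hw.2⟩
        · intro a _ b _ h
          exact Sym2.congr_right.mp h
        · intro e he
          obtain ⟨h1, h2⟩ := Finset.mem_sdiff.mp he
          obtain ⟨w, hw, rfl⟩ := Finset.mem_image.mp h1
          exact ⟨w, Finset.mem_filter.mpr ⟨hw, h2⟩, rfl⟩
      -- The induction hypothesis averages over all edges; the cost on `U` ignores the star, so the
      -- star integrates out.
      have key : ∀ U ⊆ W, bernoulliSum p q (allEdges V \ D')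
          (fun A => ((search pick (SimpleGraph.fromEdgeSet (A : Set (Sym2 V))) U).2 : ℝ)) =
          μ U.card := by
        intro U hU
        have hc := Finset.card_le_card hU
        rw [← ih U.card (by omega) U rfl, ← hunion, bernoulliSum_union p q hdisj, hunion]
        refine bernoulliSum_congr p q fun A _ => ?_
        rw [← bernoulliSum_const p q hpq D'
          ((search pick (SimpleGraph.fromEdgeSet (A : Set (Sym2 V))) U).2 : ℝ)]
        exact bernoulliSum_congr p q fun B hB => by rw [hloc U hU A B hB]
      rw [← hunion, bernoulliSum_union p q hdisj]
      trans bernoulliSum p q (allEdges V \ D') (fun A => bernoulliSum p q D' (fun B =>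
          ((search pick (SimpleGraph.fromEdgeSet (A : Set (Sym2 V)))
            (W.filter (fun w => s(v.1, w) ∉ B))).2 : ℝ)))
      · refine bernoulliSum_congr p q fun A hA => bernoulliSum_congr p q fun B hB => ?_
        rw [← hloc _ (Finset.filter_subset _ _) A B hB, ← hfil A hA B]
        congr!
      -- With the star `B` fixed on the outside, the vertex set of the call is fixed and `key`
      -- applies.
      rw [bernoulliSum_comm]
      have e2 : bernoulliSum p q D' (fun B => bernoulliSum p q (allEdges V \ D') (fun A =>
          ((search pick (SimpleGraph.fromEdgeSet (A : Set (Sym2 V)))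
            (W.filter (fun w => s(v.1, w) ∉ B))).2 : ℝ))) =
          bernoulliSum p q D' (fun B => μ (D'.card - B.card)) := by
        refine bernoulliSum_congr p q fun B hB => ?_
        rw [key _ (Finset.filter_subset _ _), hcnt B hB]
      rw [e2, bernoulliSum_card, hD'card]
    · have hlt : S.card < 2 := by omega
      simp only [search_of_card_lt_two pick _ hlt]
      rw [bernoulliSum_const p q hpq]
      have : S.card = 0 ∨ S.card = 1 := by omega
      rcases this with h | h
      · rw [← hn, h, hμ.zero]; simp
      · rw [← hn, h, hμ.one]; simp

end Search

/-! ### From the random graph measure to finite sums -/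

instance {V : Type*} [Finite V] : MeasurableSingletonClass (SimpleGraph V) where
  measurableSet_singleton G := by
    rw [← SimpleGraph.measurableEmbedding_edgeSet.measurableSet_image, Set.image_singleton]
    exact measurableSet_singleton _

lemma integral_binomialRandom {V : Type*} [Fintype V] [DecidableEq V] (p : unitInterval)
    (f : SimpleGraph V → ℝ) :
    ∫ G, f G ∂(SimpleGraph.binomialRandom V p) =
      bernoulliSum (p : ℝ) (1 - p) (allEdges V)
        (fun E => f (SimpleGraph.fromEdgeSet (E : Set (Sym2 V)))) := by
  classical
  have hcard : (allEdges V).card = (Nat.card V).choose 2 := by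
    rw [Nat.card_eq_fintype_card, ← Sym2.card_diagSet_compl, allEdges, ← Fintype.card_subtype]
    exact Fintype.card_congr (Equiv.refl _)
  rw [MeasureTheory.integral_fintype (hf := MeasureTheory.Integrable.of_finite), bernoulliSum]
  refine Finset.sum_bij (fun G _ => G.edgeSet.toFinite.toFinset) ?_ ?_ ?_ ?_
  · intro G _
    rw [Finset.mem_powerset]
    intro e he
    rw [Set.Finite.mem_toFinset] at he
    simpa [allEdges] using G.not_isDiag_of_mem_edgeSet he
  · intro G _ G' _ h
    exact SimpleGraph.edgeSet_injective (Set.Finite.toFinset_inj.mp h)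
  · intro E hE
    refine ⟨SimpleGraph.fromEdgeSet (E : Set (Sym2 V)), Finset.mem_univ _, ?_⟩
    ext e
    rw [Set.Finite.mem_toFinset, SimpleGraph.edgeSet_fromEdgeSet, Set.mem_sdiff, Finset.mem_coe]
    refine ⟨fun h => h.1, fun h => ⟨h, ?_⟩⟩
    have := Finset.mem_powerset.mp hE h
    simpa [allEdges] using this
  · intro G _
    rw [MeasureTheory.measureReal_def, SimpleGraph.binomialRandom_singleton, smul_eq_mul,
      Set.Finite.coe_toFinset, SimpleGraph.fromEdgeSet_edgeSet, hcard,
      Set.ncard_eq_toFinset_card _ G.edgeSet.toFinite]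
    simp

theorem expectedCost_eq (p : unitInterval) {μ : ℕ → ℝ}
    (hμ : IsCostSequence (p : ℝ) (1 - p) μ) (n : ℕ) (pick : BranchingRule (Fin n)) :
    expectedCost p n pick = μ n := by
  rw [expectedCost, integral_binomialRandom]
  have := bernoulliSum_search (by ring) hμ pick Finset.univ
  rw [Finset.card_univ, Fintype.card_fin] at this
  exact this

/-! ### The closed form and bounds for its terms -/

/-- The sum `∑ ℓ < n, (1 - r) ^ ℓ * (n - 1 - ℓ).choose j`, given by its recurrence in `n`. -/
noncomputable def dampedChooseSum (r : ℝ) (j : ℕ) : ℕ → ℝ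
  | 0 => 0
  | n + 1 => (1 - r) * dampedChooseSum r j n + n.choose j

/-- The contribution of index `j` to the expected cost on `n` vertices. -/
noncomputable def costTerm (q : ℝ) (j n : ℕ) : ℝ :=
  q ^ (j + 1).choose 2 * dampedChooseSum (q ^ j) j n

/-- The expected cost in closed form. -/
noncomputable def meanCost (q : ℝ) (n : ℕ) : ℝ :=
  ∑ j ∈ Finset.range n, costTerm q j n

section DampedChooseSum

lemma dampedChooseSum_of_le (r : ℝ) {j n : ℕ} (h : n ≤ j) : dampedChooseSum r j n = 0 := by
  induction n with
  | zero => rfl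
  | succ n ih => simp [dampedChooseSum, ih (by omega), Nat.choose_eq_zero_of_lt h]

lemma dampedChooseSum_nonneg {r : ℝ} (hr : r ≤ 1) (j n : ℕ) : 0 ≤ dampedChooseSum r j n := by
  induction n with
  | zero => exact le_rfl
  | succ n ih =>
    have : 0 ≤ 1 - r := by linarith
    rw [dampedChooseSum]
    positivity

lemma dampedChooseSum_one_zero (n : ℕ) : dampedChooseSum 1 0 (n + 1) = 1 := by
  simp [dampedChooseSum]

lemma cast_choose_succ_mul {j n : ℕ} (h : j ≤ n) :
    ((n + 1).choose j : ℝ) * ((n : ℝ) + 1 - j) = n.choose j * ((n : ℝ) + 1) := by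
  have := Nat.choose_mul_succ_eq n j
  have h2 : ((n + 1 - j : ℕ) : ℝ) = (n : ℝ) + 1 - j := by
    rw [Nat.cast_sub (by omega)]; push_cast; ring
  rw [← h2]
  exact_mod_cast this.symm

/-- The bound is a subsolution of the recurrence in `n`: with `m = n - j`, one step turns it into
`n.choose j * (j + m + 1) / (j + 1 + r * m)`, whose denominator is smaller than the required one. -/
lemma le_dampedChooseSum {r : ℝ} (hr0 : 0 < r) (hr1 : r ≤ 1) (j n : ℕ) :
    (n.choose j : ℝ) * ((n : ℝ) - j) / (j + 1 + r * ((n : ℝ) - j)) ≤ dampedChooseSum r j n := by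
  rcases lt_or_ge n j with h | h
  · simp [Nat.choose_eq_zero_of_lt h, dampedChooseSum_nonneg hr1]
  induction n, h using Nat.le_induction with
  | base => simp [dampedChooseSum_nonneg hr1]
  | succ n h ih =>
    obtain ⟨m, hm, hm0⟩ : ∃ m : ℝ, (n : ℝ) = j + m ∧ 0 ≤ m :=
      ⟨n - j, by ring, by rw [sub_nonneg]; exact_mod_cast h⟩
    have e := cast_choose_succ_mul h
    rw [dampedChooseSum]
    push_cast
    rw [e]
    rw [hm] at ih ⊢
    rw [show (j : ℝ) + m + 1 - j = m + 1 by ring]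
    rw [show (j : ℝ) + m - j = m by ring] at ih
    have hc : (0 : ℝ) ≤ n.choose j := by positivity
    have h1 : (n.choose j : ℝ) * (j + m + 1) / (j + 1 + r * (m + 1)) ≤
        (1 - r) * (n.choose j * m / (j + 1 + r * m)) + n.choose j := by
      have e2 : (1 - r) * ((n.choose j : ℝ) * m / (j + 1 + r * m)) + n.choose j =
          n.choose j * (j + m + 1) / (j + 1 + r * m) := by
        have : (j : ℝ) + 1 + r * m ≠ 0 := by positivity
        field_simp
        ring
      rw [e2]
      gcongr
      linarith
    have h2 := mul_le_mul_of_nonneg_left ih (sub_nonneg.mpr hr1)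
    linarith

/-- With `j` in place of `j + 1` in the denominator the same expression is a supersolution, because
`r * j ≤ j`. -/
lemma dampedChooseSum_le {r : ℝ} (hr0 : 0 < r) (hr1 : r ≤ 1) {j n : ℕ} (hn : j < n) :
    dampedChooseSum r j n ≤ (n.choose j : ℝ) * ((n : ℝ) - j) / (j + r * ((n : ℝ) - j)) := by
  induction n, Nat.succ_le_iff.mpr hn using Nat.le_induction with
  | base =>
    have : (j : ℝ) + r ≠ 0 := by positivity
    have h0 : dampedChooseSum r j j = 0 := dampedChooseSum_of_le r le_rfl
    simp only [Nat.succ_eq_add_one, dampedChooseSum, h0, Nat.choose_self, mul_zero, zero_add,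
      Nat.choose_succ_self_right]
    push_cast
    rw [show (j : ℝ) + 1 - j = 1 by ring, mul_one, mul_one, le_div_iff₀ (by positivity)]
    linarith
  | succ n h ih =>
    replace ih := ih (by omega)
    have h : j < n := h
    obtain ⟨m, hm, hm0⟩ : ∃ m : ℝ, (n : ℝ) = j + m ∧ 0 < m :=
      ⟨n - j, by ring, by rw [sub_pos]; exact_mod_cast h⟩
    have e := cast_choose_succ_mul h.le
    rw [dampedChooseSum]
    push_cast
    rw [e]
    rw [hm] at ih ⊢
    rw [show (j : ℝ) + m + 1 - j = m + 1 by ring]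
    rw [show (j : ℝ) + m - j = m by ring] at ih
    have hc : (0 : ℝ) ≤ n.choose j := by positivity
    have h1 : (1 - r) * (n.choose j * m / (j + r * m)) + n.choose j ≤
        (n.choose j : ℝ) * (j + m + 1) / (j + r * (m + 1)) := by
      have e2 : (1 - r) * ((n.choose j : ℝ) * m / (j + r * m)) + n.choose j =
          n.choose j * ((j + m) / (j + r * m)) := by
        have : (j : ℝ) + r * m ≠ 0 := by positivity
        field_simp
        ring
      rw [e2, mul_div_assoc]
      refine mul_le_mul_of_nonneg_left ?_ hc
      rw [div_le_div_iff₀ (by positivity) (by positivity)]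
      nlinarith [mul_nonneg (sub_nonneg.mpr hr1) (Nat.cast_nonneg (α := ℝ) j)]
    have h2 := mul_le_mul_of_nonneg_left ih (sub_nonneg.mpr hr1)
    linarith

lemma dampedChooseSum_le_pow {r : ℝ} (hr0 : 0 < r) (hr1 : r ≤ 1) (j n : ℕ) :
    dampedChooseSum r j n ≤ (n : ℝ) ^ j / j.factorial * (n / (j + r * n)) := by
  rcases le_or_gt n j with h | h
  · rw [dampedChooseSum_of_le r h]
    positivity
  · refine (dampedChooseSum_le hr0 hr1 h).trans ?_
    have h' : (j : ℝ) < n := by exact_mod_cast h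
    have hm : 0 < (n : ℝ) - j := sub_pos.mpr h'
    have hn : (0 : ℝ) < n := by linarith [Nat.cast_nonneg (α := ℝ) j]
    rw [mul_div_assoc]
    have h1 : (n.choose j : ℝ) ≤ (n : ℝ) ^ j / j.factorial := Nat.choose_le_pow_div j n
    refine mul_le_mul h1 ?_ (by positivity) (by positivity)
    rw [div_le_div_iff₀ (by positivity) (by positivity)]
    nlinarith [Nat.cast_nonneg (α := ℝ) j]

/-- The loss `1 / (j + 1)` comes from `j + 1` against `j` in the denominator, the loss `j * (j + 1)
/ n` from Bernoulli's inequality for `(1 - j / n) ^ (j + 1)`. For `n ≤ j` the left side is not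
positive. -/
lemma pow_mul_le_dampedChooseSum {r : ℝ} (hr0 : 0 < r) (hr1 : r ≤ 1) (j : ℕ) {n : ℕ}
    (hn : 0 < n) :
    (1 - 1 / ((j : ℝ) + 1) - j * (j + 1) / n) * ((n : ℝ) ^ j / j.factorial * (n / (j + r * n))) ≤
      dampedChooseSum r j n := by
  have hn' : (0 : ℝ) < n := by exact_mod_cast hn
  have hj : (0 : ℝ) ≤ j := Nat.cast_nonneg j
  rcases le_or_gt n j with h | h
  · have h' : (n : ℝ) ≤ j := by exact_mod_cast h
    have : 1 ≤ (j : ℝ) * (j + 1) / n := by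
      rw [le_div_iff₀ hn']; nlinarith [mul_nonneg hj hj]
    have h2 : (0 : ℝ) ≤ 1 / ((j : ℝ) + 1) := by positivity
    refine le_trans ?_ (dampedChooseSum_nonneg hr1 j n)
    exact mul_nonpos_of_nonpos_of_nonneg (by linarith) (by positivity)
  · refine le_trans ?_ (le_dampedChooseSum hr0 hr1 j n)
    have h' : (j : ℝ) < n := by exact_mod_cast h
    have hm : 0 < (n : ℝ) - j := sub_pos.mpr h'
    have hchoose : ((n : ℝ) - j) ^ j / j.factorial ≤ n.choose j := by
      rw [div_le_iff₀ (by positivity)]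
      have h1 := Nat.pow_sub_le_descFactorial n j
      have h2 := Nat.descFactorial_eq_factorial_mul_choose n j
      have h3 : ((n + 1 - j : ℕ) : ℝ) ^ j ≤ (n.choose j : ℝ) * j.factorial := by
        rw [mul_comm]; exact_mod_cast h2 ▸ h1
      refine le_trans ?_ h3
      have : (n : ℝ) - j ≤ ((n + 1 - j : ℕ) : ℝ) := by
        rw [Nat.cast_sub (by omega)]; push_cast; linarith
      gcongr
    have hbern : 1 - (j : ℝ) * (j + 1) / n ≤ (((n : ℝ) - j) / n) ^ (j + 1) := by
      have := one_add_mul_le_pow (a := -((j : ℝ) / n))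
        (by have : (j : ℝ) / n ≤ 1 := by rw [div_le_one hn']; exact h'.le
            linarith) (j + 1)
      have e : ((n : ℝ) - j) / n = 1 + -((j : ℝ) / n) := by field_simp; ring
      rw [e]
      refine le_trans (le_of_eq ?_) this
      push_cast
      ring
    have hfrac : (1 - 1 / ((j : ℝ) + 1)) * (1 / (j + r * n)) ≤
        1 / (j + 1 + r * ((n : ℝ) - j)) := by
      have e : 1 - 1 / ((j : ℝ) + 1) = j / (j + 1) := by field_simp; ring
      rw [e, div_mul_div_comm, div_le_div_iff₀ (by positivity) (by positivity)]
      have : 0 ≤ r * n := by positivity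
      have : 0 ≤ r * (j * j) := by positivity
      nlinarith
    have hcoef : 1 - 1 / ((j : ℝ) + 1) - j * (j + 1) / n ≤
        (1 - 1 / ((j : ℝ) + 1)) * (((n : ℝ) - j) / n) ^ (j + 1) := by
      have h1 : 0 ≤ 1 - 1 / ((j : ℝ) + 1) := by
        rw [sub_nonneg, div_le_one (by positivity)]; linarith
      have h2 := mul_le_mul_of_nonneg_left hbern h1
      have h3 : 0 ≤ 1 / ((j : ℝ) + 1) * (j * (j + 1) / n) := by positivity
      nlinarith
    calc _ ≤ (1 - 1 / ((j : ℝ) + 1)) * (((n : ℝ) - j) / n) ^ (j + 1) *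
          ((n : ℝ) ^ j / j.factorial * (n / (j + r * n))) := by gcongr
      _ = ((n : ℝ) - j) ^ j / j.factorial * ((n : ℝ) - j) *
          ((1 - 1 / ((j : ℝ) + 1)) * (1 / (j + r * n))) := by
        rw [div_pow]
        have : (j : ℝ) + r * n ≠ 0 := by positivity
        field_simp
        ring
      _ ≤ n.choose j * ((n : ℝ) - j) * (1 / (j + 1 + r * ((n : ℝ) - j))) := by
        have : 0 ≤ 1 - 1 / ((j : ℝ) + 1) := by
          rw [sub_nonneg, div_le_one (by positivity)]; linarith
        gcongr
      _ = _ := by ring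

end DampedChooseSum

/-! ### The closed form solves the recurrence -/

section Recurrence

/-- The expectation of `f` of a binomial variable with `n` trials and success probability `q`. -/
noncomputable def binomialMean (p q : ℝ) (n : ℕ) (f : ℕ → ℝ) : ℝ :=
  ∑ k ∈ Finset.range (n + 1), (n.choose k : ℝ) * q ^ k * p ^ (n - k) * f k

variable {p q : ℝ}

lemma binomialMean_eq_bernoulliSum (n : ℕ) (f : ℕ → ℝ) :
    binomialMean p q n f = bernoulliSum q p (Finset.range n) (fun E => f E.card) := by
  rw [bernoulliSum, Finset.sum_powerset_apply_card
    (fun m => q ^ m * p ^ ((Finset.range n).card - m) * f m), Finset.card_range, binomialMean]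
  refine Finset.sum_congr rfl fun k _ => ?_
  rw [nsmul_eq_mul]
  ring

lemma binomialMean_zero (f : ℕ → ℝ) : binomialMean p q 0 f = f 0 := by
  simp [binomialMean]

lemma binomialMean_add (n : ℕ) (f g : ℕ → ℝ) :
    binomialMean p q n (fun k => f k + g k) = binomialMean p q n f + binomialMean p q n g := by
  simp [binomialMean, mul_add, Finset.sum_add_distrib]

lemma binomialMean_mul (n : ℕ) (c : ℝ) (f : ℕ → ℝ) :
    binomialMean p q n (fun k => c * f k) = c * binomialMean p q n f := by
  rw [binomialMean, binomialMean, Finset.mul_sum]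
  exact Finset.sum_congr rfl fun k _ => by ring

lemma binomialMean_succ (n : ℕ) (f : ℕ → ℝ) :
    binomialMean p q (n + 1) f =
      p * binomialMean p q n f + q * binomialMean p q n (fun k => f (k + 1)) := by
  simp only [binomialMean_eq_bernoulliSum]
  rw [Finset.range_add_one, bernoulliSum_insert _ _ Finset.notMem_range_self]
  congr 2
  refine bernoulliSum_congr _ _ fun E hE => ?_
  rw [Finset.card_insert_of_notMem fun h => Finset.notMem_range_self (hE h)]

lemma binomialMean_choose (hpq : p + q = 1) (j n : ℕ) :
    binomialMean p q n (fun k => (k.choose j : ℝ)) = q ^ j * n.choose j := by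
  induction n generalizing j with
  | zero => cases j <;> simp [binomialMean_zero]
  | succ n ih =>
    rw [binomialMean_succ, ih]
    obtain rfl : p = 1 - q := by linarith
    cases j with
    | zero =>
      have := ih 0
      simp only [Nat.choose_zero_right, pow_zero] at this ⊢
      rw [this]
      simp
    | succ j =>
      simp only [Nat.choose_succ_succ, Nat.cast_add]
      rw [binomialMean_add, ih j, ih (j + 1)]
      ring

/-- Conditioning on one trial, both sides obey `x (n + 1) = (1 - q ^ (j + 1)) * x n + q ^ (j + 1) *
n.choose j`; on the right this is Pascal's rule. -/
lemma binomialMean_dampedChooseSum (hpq : p + q = 1) (j n : ℕ) :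
    binomialMean p q n (dampedChooseSum (q ^ j) j) =
      q ^ (j + 1) * (dampedChooseSum (q ^ (j + 1)) (j + 1) (n + 1) -
        dampedChooseSum (q ^ (j + 1)) (j + 1) n) := by
  induction n with
  | zero => simp [binomialMean_zero, dampedChooseSum]
  | succ n ih =>
    rw [binomialMean_succ]
    have h : (fun k => dampedChooseSum (q ^ j) j (k + 1)) =
        fun k => (1 - q ^ j) * dampedChooseSum (q ^ j) j k + (k.choose j : ℝ) := rfl
    rw [h, binomialMean_add, binomialMean_mul, binomialMean_choose hpq, ih]
    obtain rfl : p = 1 - q := by linarith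
    have h1 : dampedChooseSum (q ^ (j + 1)) (j + 1) (n + 1 + 1) =
      (1 - q ^ (j + 1)) * dampedChooseSum (q ^ (j + 1)) (j + 1) (n + 1) +
        (n + 1).choose (j + 1) := rfl
    have h2 : dampedChooseSum (q ^ (j + 1)) (j + 1) (n + 1) =
      (1 - q ^ (j + 1)) * dampedChooseSum (q ^ (j + 1)) (j + 1) n + n.choose (j + 1) := rfl
    rw [h1, Nat.choose_succ_succ]
    push_cast
    rw [h2]
    ring

lemma meanCost_eq_sum_range {n N : ℕ} (h : n ≤ N) :
    meanCost q n = ∑ j ∈ Finset.range N, costTerm q j n := by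
  rw [meanCost]
  refine Finset.sum_subset (Finset.range_mono h) fun j _ hj => ?_
  rw [costTerm, dampedChooseSum_of_le _ (by simpa using hj), mul_zero]

theorem isCostSequence_meanCost (hpq : p + q = 1) : IsCostSequence p q (meanCost q) where
  zero := rfl
  one := by simp [meanCost, costTerm, dampedChooseSum]
  succ n hn := by
    obtain ⟨m, rfl⟩ : ∃ m, n = m + 1 := ⟨n - 1, by omega⟩
    set n := m + 1
    rw [meanCost_eq_sum_range (show n + 1 ≤ n + 2 by omega),
      meanCost_eq_sum_range (show n ≤ n + 2 by omega), ← sub_eq_iff_eq_add',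
      ← Finset.sum_sub_distrib, Finset.sum_range_succ']
    -- Here `n ≥ 1` matters: the term `j = 0` is 0 at `n = 0` and 1 afterwards, and so supplies the
    -- initial value `μ 1 = 1`.
    have h0 : costTerm q 0 (n + 1) - costTerm q 0 n = 0 := by
      simp [costTerm, n, dampedChooseSum_one_zero]
    have h1 : ∀ j ∈ Finset.range (n + 1), costTerm q (j + 1) (n + 1) - costTerm q (j + 1) n =
        ∑ k ∈ Finset.range (n + 1), (n.choose k : ℝ) * q ^ k * p ^ (n - k) * costTerm q j k := by
      intro j _
      have := binomialMean_dampedChooseSum hpq j n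
      have e : (j + 1 + 1).choose 2 = (j + 1) + (j + 1).choose 2 := by
        rw [Nat.choose_succ_succ, Nat.choose_one_right]
      rw [costTerm, costTerm, ← mul_sub, e, pow_add, mul_right_comm, ← this, binomialMean,
        Finset.sum_mul]
      refine Finset.sum_congr rfl fun k _ => ?_
      rw [costTerm]
      ring
    rw [h0, add_zero, Finset.sum_congr rfl h1, Finset.sum_comm]
    refine Finset.sum_congr rfl fun k hk => ?_
    rw [meanCost_eq_sum_range (show k ≤ n + 1 by have := Finset.mem_range.mp hk; omega),
      Finset.mul_sum]

end Recurrence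

/-! ### The periodic function as a sum of translates -/

section Profile

/-- The function whose translates by integers sum to `periodicG`. -/
noncomputable def profile (q x : ℝ) : ℝ :=
  q ^ (x * (x + 1) / 2) / (1 + q ^ x)

variable {q : ℝ}

lemma profile_pos (hq : 0 < q) (x : ℝ) : 0 < profile q x := by
  unfold profile; positivity

lemma mul_termG (hq : 0 < q) (u : ℝ) (j : ℤ) :
    q ^ ((Int.fract u ^ 2 - Int.fract u) / 2) * termG q u j = profile q (j - Int.fract u) := by
  rw [termG, profile, mul_comm, mul_assoc, ← Real.rpow_add hq, div_mul_eq_mul_div,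
    ← Real.rpow_add hq]
  congr 2
  ring

/-- Of the three powers, one will make the sum over `j` converge and two will pay for the error
terms. -/
lemma exists_profile_mul_le (hq0 : 0 < q) (hq1 : q < 1) :
    ∃ K : ℝ, 0 < K ∧ ∀ x, profile q x * (1 + x ^ 2) ^ 3 ≤ K := by
  obtain ⟨L, hL, rfl⟩ : ∃ L : ℝ, 0 < L ∧ q = Real.exp (-L) :=
    ⟨-Real.log q, by linarith [Real.log_neg hq0 hq1], by rw [neg_neg, Real.exp_log hq0]⟩
  refine ⟨Real.exp (L / 2) * (6 * (4 / L) ^ 3), by positivity, fun x => ?_⟩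
  have h1 : profile (Real.exp (-L)) x ≤ Real.exp (L / 2) * Real.exp (-(L / 4 * (1 + x ^ 2))) := by
    rw [profile, ← Real.exp_add, ← Real.exp_mul, ← Real.exp_mul]
    refine (div_le_self (Real.exp_pos _).le (by linarith [Real.exp_pos (-L * x)])).trans ?_
    rw [Real.exp_le_exp]
    nlinarith [mul_nonneg hL.le (sq_nonneg (x + 1))]
  have h2 := Real.pow_div_factorial_le_exp (L / 4 * (1 + x ^ 2)) (by positivity) 3
  have h3 : (1 + x ^ 2) ^ 3 ≤ 6 * (4 / L) ^ 3 * Real.exp (L / 4 * (1 + x ^ 2)) := by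
    have e : (1 + x ^ 2) ^ 3 = 6 * (4 / L) ^ 3 * ((L / 4 * (1 + x ^ 2)) ^ 3 / (Nat.factorial 3 : ℕ)) := by
      norm_num [Nat.factorial]
      field_simp
    rw [e]
    gcongr
  calc _ ≤ Real.exp (L / 2) * Real.exp (-(L / 4 * (1 + x ^ 2))) *
        (6 * (4 / L) ^ 3 * Real.exp (L / 4 * (1 + x ^ 2))) := by
        gcongr
    _ = Real.exp (L / 2) * (6 * (4 / L) ^ 3) *
        (Real.exp (-(L / 4 * (1 + x ^ 2))) * Real.exp (L / 4 * (1 + x ^ 2))) := by ring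
    _ = _ := by rw [← Real.exp_add, neg_add_cancel, Real.exp_zero, mul_one]

lemma summable_one_div_one_add_sq : Summable fun j : ℤ => 1 / (1 + (j : ℝ) ^ 2) := by
  have h : Summable fun n : ℕ => 1 / (1 + (n : ℝ) ^ 2) := by
    have h1 := (summable_nat_add_iff 1).mpr (Real.summable_one_div_nat_pow.mpr one_lt_two)
    refine Summable.of_nonneg_of_le (fun n => by positivity) (fun n => ?_) (h1.mul_left 2)
    push_cast
    rw [mul_one_div, div_le_div_iff₀ (by positivity) (by positivity)]
    nlinarith [sq_nonneg ((n : ℝ) - 1)]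
  refine Summable.of_nat_of_neg ?_ ?_ <;> simpa using h

lemma exists_tsum_profile_le (hq0 : 0 < q) (hq1 : q < 1) :
    ∃ C : ℝ, 0 < C ∧ ∀ u : ℝ,
      Summable (fun j : ℤ => profile q (j - u) * (1 + (j - u) ^ 2) ^ 2) ∧
      ∑' j : ℤ, profile q (j - u) * (1 + (j - u) ^ 2) ^ 2 ≤ C := by
  obtain ⟨K, hK, hKb⟩ := exists_profile_mul_le hq0 hq1
  have hpos : 0 < ∑' j : ℤ, 1 / (1 + (j : ℝ) ^ 2) :=
    summable_one_div_one_add_sq.tsum_pos (fun j => by positivity) 0 (by positivity)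
  refine ⟨3 * K * ∑' j : ℤ, 1 / (1 + (j : ℝ) ^ 2), by positivity, fun u => ?_⟩
  have hb : ∀ j : ℤ, profile q (j - u) * (1 + (j - u) ^ 2) ^ 2 ≤
      3 * K * (1 / (1 + ((j - ⌊u⌋ : ℤ) : ℝ) ^ 2)) := by
    intro j
    have h1 := hKb (j - u)
    have e : ((j - ⌊u⌋ : ℤ) : ℝ) = (j - u) + Int.fract u := by
      push_cast; rw [Int.fract]; ring
    have h2 : 1 + (((j - ⌊u⌋ : ℤ) : ℝ)) ^ 2 ≤ 3 * (1 + (j - u) ^ 2) := by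
      rw [e]
      nlinarith [Int.fract_nonneg u, (Int.fract_lt_one u).le, sq_nonneg ((j : ℝ) - u - Int.fract u)]
    rw [mul_one_div, le_div_iff₀ (by positivity)]
    have h3 : 0 ≤ profile q (j - u) * (1 + (j - u) ^ 2) ^ 2 :=
      mul_nonneg (profile_pos hq0 _).le (by positivity)
    nlinarith [mul_le_mul_of_nonneg_left h2 h3]
  have hs : Summable fun j : ℤ => 3 * K * (1 / (1 + ((j - ⌊u⌋ : ℤ) : ℝ) ^ 2)) :=
    ((Equiv.subRight ⌊u⌋).summable_iff.mpr summable_one_div_one_add_sq).mul_left _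
  have hs' := Summable.of_nonneg_of_le
    (fun j : ℤ => mul_nonneg (profile_pos hq0 (j - u)).le (by positivity)) hb hs
  refine ⟨hs', (hs'.tsum_le_tsum hb hs).trans (le_of_eq ?_)⟩
  rw [tsum_mul_left]
  congr 1
  exact (Equiv.subRight ⌊u⌋).tsum_eq fun j : ℤ => 1 / (1 + (j : ℝ) ^ 2)

lemma profile_le_mul (hq : 0 < q) (x : ℝ) : profile q x ≤ profile q x * (1 + x ^ 2) ^ 2 :=
  le_mul_of_one_le_right (profile_pos hq x).le (one_le_pow₀ (by nlinarith [sq_nonneg x]))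

lemma summable_profile (hq0 : 0 < q) (hq1 : q < 1) (u : ℝ) :
    Summable fun j : ℤ => profile q (j - u) := by
  obtain ⟨C, -, h⟩ := exists_tsum_profile_le hq0 hq1
  exact Summable.of_nonneg_of_le (fun j => (profile_pos hq0 _).le)
    (fun j => profile_le_mul hq0 _) (h u).1

lemma summable_termG (hq0 : 0 < q) (hq1 : q < 1) (u : ℝ) : Summable (termG q u) := by
  have h := summable_profile hq0 hq1 (Int.fract u)
  simp only [← mul_termG hq0] at h
  exact (summable_mul_left_iff (Real.rpow_pos_of_pos hq0 _).ne').mp h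

lemma periodicG_eq_tsum_fract (hq : 0 < q) (u : ℝ) :
    periodicG q u = ∑' j : ℤ, profile q (j - Int.fract u) := by
  rw [periodicG, ← tsum_mul_left]
  exact tsum_congr fun j => mul_termG hq u j

lemma periodicG_eq_tsum (hq : 0 < q) (u : ℝ) :
    periodicG q u = ∑' j : ℤ, profile q (j - u) := by
  rw [periodicG_eq_tsum_fract hq, ← (Equiv.subRight ⌊u⌋).tsum_eq]
  refine tsum_congr fun j => ?_
  congr 1
  simp only [Equiv.subRight_apply, Int.cast_sub, Int.fract]
  ring

lemma periodicG_add_one (q u : ℝ) : periodicG q (u + 1) = periodicG q u := by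
  have : termG q (u + 1) = termG q u := by
    funext j
    simp only [termG, Int.fract_add_one]
  simp only [periodicG, Int.fract_add_one, this]

/-- The term `j = 0` alone suffices: with `f = Int.fract u`, its numerator has exponent `f * (f - 1)
/ 2 ≤ 0`, and its denominator is at most `1 + q⁻¹`. -/
lemma exists_le_periodicG (hq0 : 0 < q) (hq1 : q < 1) :
    ∃ c : ℝ, 0 < c ∧ ∀ u, c ≤ periodicG q u := by
  refine ⟨1 / (1 + q⁻¹), by positivity, fun u => ?_⟩
  rw [periodicG_eq_tsum_fract hq0]
  have h1 := (summable_profile hq0 hq1 (Int.fract u)).le_tsum 0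
    fun j _ => (profile_pos hq0 _).le
  refine le_trans ?_ h1
  have hf0 := Int.fract_nonneg u
  have hf1 := (Int.fract_lt_one u).le
  rw [profile]
  refine div_le_div₀ (by positivity) ?_ (by positivity) ?_
  · refine Real.one_le_rpow_of_pos_of_le_one_of_nonpos hq0 hq1.le ?_
    push_cast
    nlinarith
  · rw [← Real.rpow_neg_one]
    gcongr 1 + ?_
    refine Real.rpow_le_rpow_of_exponent_ge hq0 hq1.le ?_
    push_cast
    linarith

lemma exists_abs_periodicG_le (hq0 : 0 < q) (hq1 : q < 1) :
    ∃ B : ℝ, ∀ u, |periodicG q u| ≤ B := by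
  obtain ⟨C, -, h⟩ := exists_tsum_profile_le hq0 hq1
  refine ⟨C, fun u => ?_⟩
  rw [periodicG_eq_tsum hq0, abs_of_nonneg (tsum_nonneg fun j => (profile_pos hq0 _).le)]
  exact ((summable_profile hq0 hq1 u).tsum_le_tsum (fun j => profile_le_mul hq0 _) (h u).1).trans
    (h u).2

end Profile

/-! ### Poisson weights near and far from the mean -/

section PoissonRatio

/-- The logarithm of the Stirling sequence decreases by at most `1 / (12 n (n + 1))` per step, which
telescopes; its limit is `log √π`. -/
lemma stirlingSeq_le {j : ℕ} (hj : 0 < j) :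
    Stirling.stirlingSeq j ≤ √Real.pi * Real.exp (1 / (12 * j)) := by
  have hpos : ∀ n : ℕ, 0 < Stirling.stirlingSeq (n + 1) := Stirling.stirlingSeq'_pos
  have hmono : Monotone fun n : ℕ =>
      Real.log (Stirling.stirlingSeq (n + 1)) - 1 / (12 * ((n : ℝ) + 1)) := by
    refine monotone_nat_of_le_succ fun n => ?_
    have h := Stirling.log_stirlingSeq_sdiff_le (n + 1)
    have e : (1 : ℝ) / (12 * ((n + 1 : ℕ) : ℝ) * (((n + 1 : ℕ) : ℝ) + 1)) =
        1 / (12 * ((n : ℝ) + 1)) - 1 / (12 * (((n + 1 : ℕ) : ℝ) + 1)) := by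
      push_cast
      field_simp
      ring
    rw [e] at h
    linarith
  have hpi : (√Real.pi) ≠ 0 := by positivity
  have hlim : Filter.Tendsto (fun n : ℕ =>
      Real.log (Stirling.stirlingSeq (n + 1)) - 1 / (12 * ((n : ℝ) + 1))) Filter.atTop
      (nhds (Real.log (√Real.pi) - 0)) := by
    refine Filter.Tendsto.sub ?_ ?_
    · exact ((Real.continuousAt_log hpi).tendsto.comp Stirling.tendsto_stirlingSeq_sqrt_pi).comp
        (Filter.tendsto_add_atTop_nat 1)
    · have := (tendsto_one_div_add_atTop_nhds_zero_nat (𝕜 := ℝ)).const_mul (1 / 12)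
      rw [mul_zero] at this
      refine this.congr fun n => ?_
      field_simp
  obtain ⟨m, rfl⟩ : ∃ m, j = m + 1 := ⟨j - 1, by omega⟩
  have h := hmono.ge_of_tendsto hlim m
  rw [sub_zero] at h
  rw [← Real.exp_log (hpos m), ← Real.exp_log (show 0 < √Real.pi by positivity), ← Real.exp_add,
    Real.exp_le_exp]
  push_cast
  linarith

/-- The quotient of the size of the `j`-th term of the expected cost by its limiting shape; `N` is
the logarithm of the number of vertices to base `1 / q` and `y` is `q ^ (j - u)`. -/
noncomputable def poissonRatio (N y : ℝ) (j : ℕ) : ℝ :=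
  √(2 * Real.pi * N) * Real.exp (-N) * N ^ j / j.factorial * ((N + N * y) / (j + N * y))

lemma poissonRatio_nonneg {N y : ℝ} (hN : 0 < N) (hy : 0 < y) (j : ℕ) :
    0 ≤ poissonRatio N y j := by
  unfold poissonRatio; positivity

lemma poisson_eq {N : ℝ} (hN : 0 < N) {j : ℕ} (hj : 0 < j) :
    √(2 * Real.pi * N) * Real.exp (-N) * N ^ j / j.factorial =
      √(N / j) * (√Real.pi / Stirling.stirlingSeq j) *
        Real.exp (j - N + j * Real.log (N / j)) := by
  have hj' : (0 : ℝ) < j := by exact_mod_cast hj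
  have e1 : (N : ℝ) ^ j = Real.exp (j * Real.log N) := by
    rw [mul_comm, Real.exp_mul, Real.exp_log hN, Real.rpow_natCast]
  have e2 : ((j : ℝ) / Real.exp 1) ^ j = Real.exp (j * (Real.log j - 1)) := by
    rw [mul_comm, Real.exp_mul, Real.exp_sub, Real.exp_log hj', Real.rpow_natCast]
  have e3 : Real.exp (j - N + j * Real.log (N / j)) =
      Real.exp (-N) * Real.exp (j * Real.log N) / Real.exp (j * (Real.log j - 1)) := by
    rw [← Real.exp_add, ← Real.exp_sub, Real.log_div hN.ne' hj'.ne']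
    congr 1
    ring
  rw [Stirling.stirlingSeq, e1, e2, e3, Real.sqrt_div hN.le, Real.sqrt_mul (by positivity),
    Real.sqrt_mul (by positivity), Real.sqrt_mul (by positivity)]
  have h1 : √(j : ℝ) ≠ 0 := by positivity
  field_simp

lemma one_sub_add_le_mul {x y a b : ℝ} (hx : 0 ≤ x) (hy : 0 ≤ y) (ha : 0 ≤ a) (hb : 0 ≤ b)
    (hxa : 1 - a ≤ x) (hyb : 1 - b ≤ y) : 1 - (a + b) ≤ x * y := by
  rcases le_or_gt 1 a with h | h
  · exact le_trans (by linarith) (mul_nonneg hx hy)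
  rcases le_or_gt 1 b with h' | h'
  · exact le_trans (by linarith) (mul_nonneg hx hy)
  calc 1 - (a + b) ≤ (1 - a) * (1 - b) := by nlinarith
    _ ≤ x * y := mul_le_mul hxa hyb (by linarith) hx

/-- Stirling's formula splits the ratio into four factors, each close to 1. The square root and the
last factor deviate by at most `2 |j - N| / N`; in the exponential, `1 - 1 / t ≤ log t ≤ t - 1` at
`t = N / j` costs `(j - N) ^ 2 / N`. -/
lemma abs_poissonRatio_sub_one_le {N y : ℝ} (hN : 1 ≤ N) (hy : 0 < y) {j : ℕ}
    (hj : N / 2 ≤ j) :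
    |poissonRatio N y j - 1| ≤ 6 * (1 + ((j : ℝ) - N) ^ 2) / N := by
  have hN0 : 0 < N := by linarith
  have hj' : (0 : ℝ) < j := by linarith
  have hj0 : 0 < j := by exact_mod_cast hj'
  set d := (j : ℝ) - N with hd
  have hjd : (j : ℝ) = N + d := by rw [hd]; ring
  have hd0 := abs_nonneg d
  have hd2 : d ^ 2 = |d| ^ 2 := (sq_abs d).symm
  have hdd : 2 * |d| ≤ 1 + d ^ 2 := by rw [hd2]; nlinarith [sq_nonneg (|d| - 1)]
  obtain ⟨δ, hδ⟩ : ∃ δ, δ = |d| / N := ⟨_, rfl⟩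
  have hδ0 : 0 ≤ δ := by rw [hδ]; positivity
  have hδN : δ * N = |d| := by rw [hδ]; field_simp
  have hup : N ≤ (1 + 2 * δ) * j := by
    have h1 := neg_abs_le d
    nlinarith
  have hlow : (1 - δ) * j ≤ N := by
    have h1 := le_abs_self d
    rcases le_or_gt d 0 with h | h
    · nlinarith
    · rw [abs_of_pos h] at hδN; nlinarith
  have hδd : δ ≤ (1 + d ^ 2) / N / 2 := by
    rw [hδ, div_div, div_le_div_iff₀ hN0 (by positivity)]; nlinarith
  have s1u : √(N / j) ≤ 1 + 2 * δ := by
    rw [Real.sqrt_le_left (by positivity), div_le_iff₀ hj']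
    nlinarith [mul_nonneg hδ0 hj'.le, mul_nonneg (mul_nonneg hδ0 hδ0) hj'.le]
  have s1l : 1 - δ ≤ √(N / j) := by
    rcases le_or_gt 1 δ with h | h
    · exact le_trans (by linarith) (Real.sqrt_nonneg _)
    refine Real.le_sqrt_of_sq_le ?_
    rw [le_div_iff₀ hj']
    have : (1 - δ) ^ 2 ≤ 1 - δ := by nlinarith
    nlinarith
  have hs := Stirling.sqrt_pi_le_stirlingSeq hj0.ne'
  have hpi : 0 < √Real.pi := by positivity
  have hspos : 0 < Stirling.stirlingSeq j := hpi.trans_le hs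
  have s2u : √Real.pi / Stirling.stirlingSeq j ≤ 1 := by rwa [div_le_one hspos]
  have s2l : 1 - 1 / N ≤ √Real.pi / Stirling.stirlingSeq j := by
    have h1 := stirlingSeq_le hj0
    have h2 : Real.exp (-(1 / (12 * (j : ℝ)))) ≤ √Real.pi / Stirling.stirlingSeq j := by
      rw [le_div_iff₀ hspos, Real.exp_neg, inv_mul_le_iff₀ (Real.exp_pos _), mul_comm]
      exact h1
    have h3 := Real.add_one_le_exp (-(1 / (12 * (j : ℝ))))
    have h4 : 1 / (12 * (j : ℝ)) ≤ 1 / N := one_div_le_one_div_of_le hN0 (by linarith)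
    linarith
  have s3u : Real.exp (j - N + j * Real.log (N / j)) ≤ 1 := by
    rw [Real.exp_le_one_iff]
    have h1 := Real.log_le_sub_one_of_pos (show 0 < N / j by positivity)
    have h2 := mul_le_mul_of_nonneg_left h1 hj'.le
    have h3 : (j : ℝ) * (N / j - 1) = N - j := by field_simp
    linarith
  have s3l : 1 - d ^ 2 / N ≤ Real.exp (j - N + j * Real.log (N / j)) := by
    refine le_trans ?_ (Real.add_one_le_exp _)
    have h1 := Real.one_sub_inv_le_log_of_pos (show 0 < N / j by positivity)
    have h2 := mul_le_mul_of_nonneg_left h1 hj'.le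
    have h3 : (j : ℝ) * (1 - (N / j)⁻¹) = -(j - N) - d ^ 2 / N := by
      rw [hjd, inv_div]; field_simp; ring
    linarith
  have hden : 0 < (j : ℝ) + N * y := by positivity
  have s4u : (N + N * y) / (j + N * y) ≤ 1 + 2 * δ := by
    rw [div_le_iff₀ hden]
    nlinarith [mul_nonneg hδ0 (mul_nonneg hN0.le hy.le)]
  have s4l : 1 - δ ≤ (N + N * y) / (j + N * y) := by
    rw [le_div_iff₀ hden]
    nlinarith [mul_nonneg hδ0 (mul_nonneg hN0.le hy.le)]
  have e : poissonRatio N y j = √(N / j) * (√Real.pi / Stirling.stirlingSeq j) *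
        Real.exp (j - N + j * Real.log (N / j)) * ((N + N * y) / (j + N * y)) := by
    rw [poissonRatio, poisson_eq hN0 hj0]
  have p4 : 0 ≤ (N + N * y) / (j + N * y) := by positivity
  have hNpos : 0 ≤ 1 / N := by positivity
  have hdN : 0 ≤ d ^ 2 / N := by positivity
  have hsum : 6 * (1 + d ^ 2) / N = 6 * (1 / N) + 6 * (d ^ 2 / N) := by ring
  have hδd' : 2 * δ ≤ 1 / N + d ^ 2 / N := by
    have : (1 + d ^ 2) / N / 2 = (1 / N + d ^ 2 / N) / 2 := by ring
    linarith
  rw [hsum, abs_le]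
  constructor
  · have h12 := one_sub_add_le_mul (Real.sqrt_nonneg _) (by positivity) hδ0 hNpos s1l s2l
    have h123 := one_sub_add_le_mul (by positivity) (Real.exp_pos _).le (by positivity) hdN h12 s3l
    have h1234 := one_sub_add_le_mul (by positivity) p4 (by positivity) hδ0 h123 s4l
    rw [e]
    linarith
  · have hδδ : δ ^ 2 ≤ d ^ 2 / N := by
      rw [hδ, div_pow, sq_abs]
      exact div_le_div_of_nonneg_left (sq_nonneg d) hN0 (by nlinarith)
    have h : poissonRatio N y j ≤ (1 + 2 * δ) * 1 * 1 * (1 + 2 * δ) := by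
      rw [e]
      gcongr
    nlinarith

/-- A crude bound for `j` far below `N`. At `j = 0` the last factor is `(1 + y) / y`, hence the
condition on `y`. -/
lemma poissonRatio_le {N y : ℝ} (hN : 2 ≤ N) (hy : 0 < y) {j : ℕ} (hj : j = 0 → 1 ≤ y) :
    poissonRatio N y j ≤ 3 * N ^ 2 := by
  have hN0 : 0 < N := by linarith
  have h1 : Real.exp (-N) * N ^ j / j.factorial ≤ 1 := by
    have := Real.pow_div_factorial_le_exp N hN0.le j
    rw [mul_div_assoc, Real.exp_neg, inv_mul_le_iff₀ (Real.exp_pos _), mul_one]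
    exact this
  have h2 : (N + N * y) / (j + N * y) ≤ N := by
    rw [div_le_iff₀ (by positivity)]
    rcases Nat.eq_zero_or_pos j with h | h
    · have := hj h
      subst h
      push_cast
      nlinarith [mul_nonneg hN0.le (sub_nonneg.mpr this), mul_pos hN0 hy]
    · have : (1 : ℝ) ≤ j := by exact_mod_cast h
      nlinarith [mul_pos hN0 hy]
  have h3 : √(2 * Real.pi * N) ≤ 3 * N := by
    rw [Real.sqrt_le_left (by positivity)]
    nlinarith [Real.pi_lt_four]
  calc poissonRatio N y j = √(2 * Real.pi * N) * (Real.exp (-N) * N ^ j / j.factorial) *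
        ((N + N * y) / (j + N * y)) := by rw [poissonRatio]; ring
    _ ≤ 3 * N * 1 * N := by gcongr
    _ = 3 * N ^ 2 := by ring

end PoissonRatio

/-! ### Comparison with the main term -/

section MainTerm

/-- The factor of the main term that does not come from `periodicG`, where `L = log (1 / q)`,
`N = log n / L` and `u = N - log N / L`. -/
noncomputable def growthFactor (L N : ℝ) : ℝ :=
  Real.exp (N + L * (N - Real.log N / L) / 2 + L * (N - Real.log N / L) ^ 2 / 2) /
    (√(2 * Real.pi) * √N)

variable {L N : ℝ}

lemma growthFactor_pos (hN : 0 < N) : 0 < growthFactor L N := by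
  unfold growthFactor; positivity

lemma exp_mul_eq (hL : 0 < L) (hN : 0 < N) :
    Real.exp (L * N) = N * Real.exp (L * (N - Real.log N / L)) := by
  nth_rewrite 2 [← Real.exp_log hN]
  rw [← Real.exp_add]
  congr 1
  field_simp
  ring

lemma mainTerm_eq (hL : 0 < L) (hN : 0 < N) :
    mainTerm (Real.exp (-L)) (Real.exp (L * N)) =
      growthFactor L N * periodicG (Real.exp (-L)) (N - Real.log N / L) := by
  have h1 : 1 / Real.exp (-L) = Real.exp L := by rw [Real.exp_neg, one_div, inv_inv]
  have h2 : Real.logb (Real.exp L) (Real.exp (L * N)) = N := by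
    rw [Real.logb, Real.log_exp, Real.log_exp]; field_simp
  have h3 : Real.log (Real.exp (L * N) / N) = L * (N - Real.log N / L) := by
    rw [Real.log_div (Real.exp_pos _).ne' hN.ne', Real.log_exp]; field_simp
  have h4 : Real.logb (Real.exp L) (Real.exp (L * N) / N) = N - Real.log N / L := by
    rw [Real.logb, h3, Real.log_exp]; field_simp
  have h5 : Real.exp (L * N) ^ (1 / L + 1 / 2) =
      Real.exp (N + L * (N - Real.log N / L) / 2) * √N := by
    have : √N = Real.exp (Real.log N / 2) := by rw [Real.exp_half, Real.exp_log hN]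
    rw [this, ← Real.exp_mul, ← Real.exp_add]
    congr 1
    field_simp
    ring
  have h6 : (L * (N - Real.log N / L)) ^ 2 / (2 * L) = L * (N - Real.log N / L) ^ 2 / 2 := by
    field_simp
  simp only [mainTerm, h1, h2, h3, h4, h5, h6, Real.log_exp]
  rw [growthFactor, Real.exp_add (N + _)]
  have h7 : √N * √N = N := Real.mul_self_sqrt hN.le
  have h8 : √N ≠ 0 := by positivity
  have h9 : √(2 * Real.pi) ≠ 0 := by positivity
  have h10 : √N / N = 1 / √N := by rw [div_eq_div_iff hN.ne' h8, h7, one_mul]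
  rw [mul_div_assoc (Real.exp (N + _)), h10]
  field_simp

/-- Put `n = N * exp (L * u)`: then `q ^ j * n = N * y`, and completing the square in the exponent
of `q` leaves `(j - u) * (j - u + 1) / 2`. -/
lemma pow_mul_eq_growthFactor_mul (hL : 0 < L) (hN : 0 < N) (j : ℕ) :
    Real.exp (-L) ^ (j + 1).choose 2 * (Real.exp (L * N) ^ j / j.factorial *
      (Real.exp (L * N) / (j + Real.exp (-L) ^ j * Real.exp (L * N)))) =
    growthFactor L N * profile (Real.exp (-L)) (j - (N - Real.log N / L)) *
      poissonRatio N (Real.exp (-L * (j - (N - Real.log N / L)))) j := by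
  have e0 := exp_mul_eq hL hN
  rw [growthFactor, profile, poissonRatio]
  set u := N - Real.log N / L
  set y := Real.exp (-L * (j - u)) with hy
  have h1 : Real.exp (-L) ^ j * Real.exp (L * N) = N * y := by
    rw [e0, ← Real.exp_nat_mul, hy, mul_left_comm, ← Real.exp_add]
    congr 2
    ring
  have h2 : Real.exp (-L) ^ (j + 1).choose 2 = Real.exp (-L * (j * (j + 1) / 2)) := by
    rw [← Real.exp_nat_mul, Nat.cast_choose_two]
    congr 1
    push_cast
    ring
  have h3 : Real.exp (-L) ^ ((j : ℝ) - u) = y := by rw [← Real.exp_mul]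
  have h4 : Real.exp (L * N) ^ j = N ^ j * Real.exp (L * u * j) := by
    rw [e0, mul_pow, ← Real.exp_nat_mul, mul_comm (j : ℝ)]
  have hE : Real.exp (-L * (j * (j + 1) / 2)) * Real.exp (L * u * j) * Real.exp (L * u) =
      Real.exp (N + L * u / 2 + L * u ^ 2 / 2) *
        Real.exp (-L) ^ (((j : ℝ) - u) * (j - u + 1) / 2) * Real.exp (-N) := by
    rw [← Real.exp_mul, ← Real.exp_add, ← Real.exp_add, ← Real.exp_add, ← Real.exp_add]
    congr 1
    ring
  have hypos : 0 < y := Real.exp_pos _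
  have h5 : (√N) ≠ 0 := by positivity
  have h6 : √(2 * Real.pi) ≠ 0 := by positivity
  have h7 : (j : ℝ) + N * y ≠ 0 := by positivity
  have h8 : 1 + y ≠ 0 := by positivity
  rw [h1, h2, h3, h4, e0, Real.sqrt_mul (show 0 ≤ 2 * Real.pi by positivity)]
  clear_value y u
  calc _ = (Real.exp (-L * (j * (j + 1) / 2)) * Real.exp (L * u * j) * Real.exp (L * u)) *
        (N ^ j / j.factorial * (N / (j + N * y))) := by ring
    _ = _ := by
      rw [hE]
      generalize √(2 * Real.pi) = s at *
      field_simp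

lemma abs_sub_le_of_ratio {B c ρ δ η : ℝ} (hB : 0 ≤ B) (hc : 0 ≤ c) (hρ0 : 0 ≤ ρ) (hδ : 0 ≤ δ)
    (hup : c ≤ B * ρ) (hlo : (1 - δ) * (B * ρ) ≤ c) (hρ : |ρ - 1| ≤ η) :
    |c - B| ≤ B * (δ + η) := by
  have hη : 0 ≤ η := (abs_nonneg _).trans hρ
  obtain ⟨h1, h2⟩ := abs_le.mp hρ
  rw [abs_le]
  constructor
  · rcases le_or_gt 1 δ with h | h
    · nlinarith [mul_le_mul_of_nonneg_left (show 1 ≤ δ + η by linarith) hB]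
    · have h3 := one_sub_add_le_mul (show 0 ≤ 1 - δ by linarith) hρ0 hδ hη le_rfl
        (show 1 - η ≤ ρ by linarith)
      nlinarith [mul_le_mul_of_nonneg_left h3 hB]
  · nlinarith [mul_le_mul_of_nonneg_left (show ρ - 1 ≤ δ + η by linarith) hB]

lemma abs_costTerm_sub_le (hL : 0 < L) (hN : 2 ≤ N) (hlam : Real.log N / L ≤ N / 4) {n : ℕ}
    (hn : (n : ℝ) = Real.exp (L * N)) (hN3 : N ^ 3 ≤ n) (j : ℕ) :
    |costTerm (Real.exp (-L)) j n -
        growthFactor L N * profile (Real.exp (-L)) (j - (N - Real.log N / L))| ≤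
      256 * (1 + (Real.log N / L) ^ 2) / N *
        (growthFactor L N * (profile (Real.exp (-L)) (j - (N - Real.log N / L)) *
          (1 + (j - (N - Real.log N / L)) ^ 2) ^ 2)) := by
  have hN0 : 0 < N := by linarith
  have hn0 : (0 : ℝ) < n := by rw [hn]; exact Real.exp_pos _
  have hr0 : 0 < Real.exp (-L) ^ j := by positivity
  have hr1 : Real.exp (-L) ^ j ≤ 1 :=
    pow_le_one₀ (Real.exp_pos _).le (Real.exp_le_one_iff.mpr (by linarith))
  have hup := mul_le_mul_of_nonneg_left (dampedChooseSum_le_pow hr0 hr1 j n)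
    (show 0 ≤ Real.exp (-L) ^ (j + 1).choose 2 by positivity)
  have hlo := mul_le_mul_of_nonneg_left
    (pow_mul_le_dampedChooseSum hr0 hr1 j (show 0 < n by exact_mod_cast hn0))
    (show 0 ≤ Real.exp (-L) ^ (j + 1).choose 2 by positivity)
  have hc0 : 0 ≤ costTerm (Real.exp (-L)) j n := by
    have := dampedChooseSum_nonneg hr1 j n
    unfold costTerm; positivity
  rw [mul_left_comm] at hlo
  rw [hn, pow_mul_eq_growthFactor_mul hL hN0] at hup hlo
  rw [← hn] at hlo
  have hB : 0 < growthFactor L N * profile (Real.exp (-L)) (j - (N - Real.log N / L)) :=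
    mul_pos (growthFactor_pos hN0) (profile_pos (Real.exp_pos _) _)
  rw [← mul_assoc (growthFactor L N)]
  change _ ≤ costTerm (Real.exp (-L)) j n at hlo
  have hup' : costTerm (Real.exp (-L)) j n ≤ _ := hup
  clear hup
  set c := costTerm (Real.exp (-L)) j n
  set l := Real.log N / L
  set B := growthFactor L N * profile (Real.exp (-L)) (j - (N - l))
  have hy : 0 < Real.exp (-L * (j - (N - l))) := Real.exp_pos _
  have hρ0 := poissonRatio_nonneg hN0 hy j
  have hj0 : (0 : ℝ) ≤ j := Nat.cast_nonneg j
  clear_value B c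
  generalize hx : (j : ℝ) - (N - l) = x at *
  suffices h : |c - B| ≤ B * (256 * (1 + l ^ 2) * (1 + x ^ 2) ^ 2 / N) by
    refine h.trans (le_of_eq ?_)
    ring
  rcases le_or_gt (N / 2) j with hj | hj
  · have hρ := abs_poissonRatio_sub_one_le (by linarith) hy hj
    generalize poissonRatio N (Real.exp (-L * x)) j = ρ at *
    have hδ : 0 ≤ 1 / ((j : ℝ) + 1) + j * (j + 1) / n := by positivity
    rw [sub_sub] at hlo
    refine (abs_sub_le_of_ratio hB.le hc0 hρ0 hδ hup' hlo hρ).trans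
      (mul_le_mul_of_nonneg_left ?_ hB.le)
    have hd : (j : ℝ) - N = x - l := by rw [← hx]; ring
    have hjd : (j : ℝ) = N + (x - l) := by rw [← hx]; ring
    rw [hd]
    obtain ⟨d, hdef⟩ : ∃ d, d = x - l := ⟨_, rfl⟩
    rw [← hdef] at hjd ⊢
    have h1 : 1 / ((j : ℝ) + 1) ≤ 2 / N := by
      rw [div_le_div_iff₀ (by positivity) hN0]; linarith
    have h2 : (j : ℝ) * (j + 1) / n ≤ 4 * (1 + d ^ 2) / N := by
      rw [div_le_div_iff₀ hn0 hN0]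
      have h3 : (j : ℝ) * (j + 1) ≤ 4 * N ^ 2 + 4 * d ^ 2 := by
        have h31 : (j : ℝ) * (j + 1) ≤ 2 * (j : ℝ) ^ 2 := by nlinarith
        have h32 : (j : ℝ) ^ 2 ≤ 2 * N ^ 2 + 2 * d ^ 2 := by
          rw [hjd]; nlinarith [sq_nonneg (N - d)]
        linarith
      have h4 : N ≤ n := le_trans (by nlinarith [sq_nonneg N]) hN3
      have h5 := mul_le_mul_of_nonneg_right h3 hN0.le
      have h6 := mul_le_mul_of_nonneg_left h4 (sq_nonneg d)
      linarith
    -- Splitting `d = x - l` is what brings `l = log N / L` into the error.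
    have h7 : (1 + d ^ 2) ≤ 2 * ((1 + l ^ 2) * (1 + x ^ 2) ^ 2) := by
      have h8 : 1 + d ^ 2 ≤ 2 * ((1 + l ^ 2) * (1 + x ^ 2)) := by
        rw [hdef]; nlinarith [sq_nonneg (x + l), sq_nonneg (x * l)]
      have h9 : 1 + x ^ 2 ≤ (1 + x ^ 2) ^ 2 := by nlinarith [sq_nonneg x]
      have h10 := mul_le_mul_of_nonneg_left h9 (show 0 ≤ 1 + l ^ 2 by positivity)
      linarith
    have h8 : 12 * (1 + d ^ 2) / N ≤ 256 * (1 + l ^ 2) * (1 + x ^ 2) ^ 2 / N := by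
      have h9 : 0 ≤ (1 + l ^ 2) * (1 + x ^ 2) ^ 2 := by positivity
      exact div_le_div_of_nonneg_right (by linarith) hN0.le
    have h9 : 2 / N ≤ 2 * (1 + d ^ 2) / N :=
      div_le_div_of_nonneg_right (by linarith [sq_nonneg d]) hN0.le
    have e12 : 12 * (1 + d ^ 2) / N = 2 * (1 + d ^ 2) / N + 4 * (1 + d ^ 2) / N +
      6 * (1 + d ^ 2) / N := by ring
    linarith
  -- For `j < N / 2`, `l ≤ N / 4` puts `j` at least `N / 4` below `u`, so powers of `x` beat the
  -- crude bound: `N + 3 * N ^ 3 ≤ 4 * N ^ 3 ≤ 256 * (-x) ^ 3`.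
  · have hxN : N ≤ 4 * -x := by rw [← hx]; linarith
    have hρ := poissonRatio_le hN hy (j := j) (by
      intro h
      rw [Real.one_le_exp_iff]
      nlinarith)
    have h1 : 1 + 3 * N ^ 2 ≤ 256 * (1 + l ^ 2) * (1 + x ^ 2) ^ 2 / N := by
      rw [le_div_iff₀ hN0]
      have h2 : N ^ 3 ≤ (4 * -x) ^ 3 := pow_le_pow_left₀ hN0.le hxN 3
      have h3 : (-x) ^ 3 ≤ (1 + x ^ 2) ^ 2 := by
        nlinarith [sq_nonneg (x * (x + 1)), sq_nonneg x, sq_nonneg (x ^ 2)]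
      have h4 : (1 + x ^ 2) ^ 2 ≤ (1 + l ^ 2) * (1 + x ^ 2) ^ 2 :=
        le_mul_of_one_le_left (by positivity) (by linarith [sq_nonneg l])
      have h5 : N ≤ N ^ 3 := by nlinarith [sq_nonneg N]
      have h6 : (4 * -x) ^ 3 = 64 * (-x) ^ 3 := by ring
      linarith
    refine le_trans ?_ (mul_le_mul_of_nonneg_left h1 hB.le)
    have h5 := mul_le_mul_of_nonneg_left hρ hB.le
    have h6 := mul_nonneg hB.le (sq_nonneg N)
    rw [abs_le]
    constructor <;> linarith

lemma abs_meanCost_sub_le (hL : 0 < L) (hN : 2 ≤ N) (hlam : Real.log N / L ≤ N / 4) {n : ℕ}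
    (hn : (n : ℝ) = Real.exp (L * N)) (hN3 : N ^ 3 ≤ n) {C : ℝ}
    (hs : Summable (fun j : ℤ => profile (Real.exp (-L)) (j - (N - Real.log N / L)) *
      (1 + (j - (N - Real.log N / L)) ^ 2) ^ 2))
    (hC : ∑' j : ℤ, profile (Real.exp (-L)) (j - (N - Real.log N / L)) *
      (1 + (j - (N - Real.log N / L)) ^ 2) ^ 2 ≤ C) :
    |meanCost (Real.exp (-L)) n - mainTerm (Real.exp (-L)) n| ≤
      256 * (1 + (Real.log N / L) ^ 2) / N * (growthFactor L N * C) := by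
  have hN0 : 0 < N := by linarith
  have hq0 : 0 < Real.exp (-L) := Real.exp_pos _
  have hq1 : Real.exp (-L) < 1 := Real.exp_lt_one_iff.mpr (by linarith)
  have hG := growthFactor_pos (L := L) hN0
  have h1 : HasSum (fun j : ℕ => costTerm (Real.exp (-L)) j n) (meanCost (Real.exp (-L)) n) :=
    hasSum_sum_of_ne_finset_zero fun j hj => by
      rw [costTerm, dampedChooseSum_of_le _ (by simpa using hj), mul_zero]
  have h2 := (hasSum_extend_zero (Nat.cast_injective (R := ℤ))).mpr h1
  have h3 := ((summable_profile hq0 hq1 (N - Real.log N / L)).hasSum).mul_left (growthFactor L N)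
  rw [hn, mainTerm_eq hL hN0, periodicG_eq_tsum hq0]
  have h4 := (hs.hasSum.mul_left (growthFactor L N)).mul_left
    (256 * (1 + (Real.log N / L) ^ 2) / N)
  refine le_trans ((h2.sub h3).norm_le_of_bounded h4 fun j => ?_) ?_
  · rw [Real.norm_eq_abs]
    rcases lt_or_ge j 0 with hj | hj
    -- Negative `j` occur only in the bilateral series. There `j - u` is below `-N / 2`, so the
    -- profile itself fits in the error.
    · rw [Function.extend_apply' _ _ _ (by rintro ⟨a, rfl⟩; omega), Pi.zero_apply, zero_sub,
        abs_neg, abs_of_pos (mul_pos hG (profile_pos hq0 _)), mul_left_comm]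
      refine mul_le_mul_of_nonneg_left ?_ hG.le
      rw [mul_left_comm]
      refine le_mul_of_one_le_right (profile_pos hq0 _).le ?_
      have hj' : (j : ℝ) < 0 := by exact_mod_cast hj
      obtain ⟨x, hx⟩ : ∃ x, x = (j : ℝ) - (N - Real.log N / L) := ⟨_, rfl⟩
      rw [← hx]
      have hxN : N ≤ 2 * -x := by rw [hx]; linarith
      rw [div_mul_eq_mul_div, one_le_div hN0]
      have h5 : -x ≤ (1 + x ^ 2) ^ 2 := by nlinarith [sq_nonneg (x + 1), sq_nonneg (x ^ 2)]
      have h6 : (1 + x ^ 2) ^ 2 ≤ (1 + (Real.log N / L) ^ 2) * (1 + x ^ 2) ^ 2 :=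
        le_mul_of_one_le_left (by positivity) (by nlinarith [sq_nonneg (Real.log N / L)])
      have h7 : 0 ≤ (1 + x ^ 2) ^ 2 := by positivity
      linarith
    · obtain ⟨m, rfl⟩ := Int.eq_ofNat_of_zero_le hj
      have := abs_costTerm_sub_le hL hN hlam hn hN3 m
      rw [Nat.cast_injective.extend_apply]
      exact_mod_cast this
  · gcongr

end MainTerm

/-! ### The relative error -/

open Filter Asymptotics in
lemma isBigO_meanCost {L : ℝ} (hL : 0 < L) :
    (∀ᶠ n : ℕ in atTop, mainTerm (Real.exp (-L)) n ≠ 0) ∧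
    (fun n : ℕ => meanCost (Real.exp (-L)) n / mainTerm (Real.exp (-L)) n - 1) =O[atTop]
      fun n : ℕ => Real.log (Real.log n) ^ 2 / Real.log n := by
  have hq0 : 0 < Real.exp (-L) := Real.exp_pos _
  have hq1 : Real.exp (-L) < 1 := Real.exp_lt_one_iff.mpr (by linarith)
  obtain ⟨C, hC0, hC⟩ := exists_tsum_profile_le hq0 hq1
  obtain ⟨c, hc0, hc⟩ := exists_le_periodicG hq0 hq1
  have hlog : Tendsto (fun n : ℕ => Real.log n) atTop atTop :=
    Real.tendsto_log_atTop.comp tendsto_natCast_atTop_atTop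
  have hloglog : Tendsto (fun n : ℕ => Real.log (Real.log n)) atTop atTop :=
    Real.tendsto_log_atTop.comp hlog
  have hNt : Tendsto (fun n : ℕ => Real.log n / L) atTop atTop := hlog.atTop_div_const hL
  have ev1 := hNt.eventually_ge_atTop 2
  have ev2 : ∀ᶠ n : ℕ in atTop, Real.log (Real.log n / L) / L ≤ Real.log n / L / 4 := by
    have h := hNt.eventually (Real.isLittleO_log_id_atTop.bound (show 0 < L / 4 by positivity))
    filter_upwards [h, ev1] with n hn h2
    rw [Real.norm_eq_abs, Real.norm_eq_abs, id, abs_of_pos (show 0 < Real.log n / L by linarith)]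
      at hn
    rw [div_le_iff₀ hL]
    linarith [le_abs_self (Real.log (Real.log n / L))]
  have ev3 : ∀ᶠ n : ℕ in atTop, (Real.log n / L) ^ 3 ≤ n := by
    have h := tendsto_natCast_atTop_atTop.eventually
      ((Real.isLittleO_pow_log_id_atTop (n := 3)).bound (show 0 < L ^ 3 by positivity))
    filter_upwards [h] with n hn
    rw [Real.norm_eq_abs, Real.norm_eq_abs, id, Nat.abs_cast] at hn
    rw [div_pow, div_le_iff₀ (by positivity)]
    linarith [le_abs_self (Real.log (n : ℝ) ^ 3)]
  have ev4 := hloglog.eventually_ge_atTop (max 1 |Real.log L|)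
  have ev5 := eventually_gt_atTop 0
  have key : ∀ᶠ n : ℕ in atTop, 0 < mainTerm (Real.exp (-L)) n ∧
      ‖meanCost (Real.exp (-L)) n / mainTerm (Real.exp (-L)) n - 1‖ ≤
        256 * C / c * L * (1 + 4 / L ^ 2) * ‖Real.log (Real.log n) ^ 2 / Real.log n‖ := by
    filter_upwards [ev1, ev2, ev3, ev4, ev5] with n h1 h2 h3 h4 h5
    have hn0 : (0 : ℝ) < n := by exact_mod_cast h5
    have hl0 : 0 < Real.log n := by
      have : 0 < Real.log n / L := by linarith
      exact (div_pos_iff_of_pos_right hL).mp this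
    have hn : (n : ℝ) = Real.exp (L * (Real.log n / L)) := by
      rw [mul_div_cancel₀ _ hL.ne', Real.exp_log hn0]
    set N := Real.log n / L with hN
    have hN0 : 0 < N := by linarith
    have hb := abs_meanCost_sub_le hL h1 h2 hn h3 (hC _).1 (hC _).2
    have hm : mainTerm (Real.exp (-L)) n =
        growthFactor L N * periodicG (Real.exp (-L)) (N - Real.log N / L) := by
      rw [hn]; exact mainTerm_eq hL hN0
    have hG := growthFactor_pos (L := L) hN0
    have hmc : growthFactor L N * c ≤ mainTerm (Real.exp (-L)) n := by
      rw [hm]; exact mul_le_mul_of_nonneg_left (hc _) hG.le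
    have hm0 : 0 < mainTerm (Real.exp (-L)) n := lt_of_lt_of_le (by positivity) hmc
    refine ⟨hm0, ?_⟩
    set t := Real.log (Real.log n)
    have ht1 : 1 ≤ t := le_trans (le_max_left _ _) h4
    have ht2 : |Real.log L| ≤ t := le_trans (le_max_right _ _) h4
    -- `log N = t - log L` and `|log L| ≤ t` give `|log N| ≤ 2 * t`, hence the 4.
    have hlamsq : 1 + (Real.log N / L) ^ 2 ≤ (1 + 4 / L ^ 2) * t ^ 2 := by
      have e : Real.log N = t - Real.log L := by
        rw [hN, Real.log_div hl0.ne' hL.ne']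
      have hsq : (Real.log N) ^ 2 ≤ 4 * t ^ 2 := by
        rw [e]
        nlinarith [abs_le.mp ht2]
      rw [div_pow, add_mul, one_mul, div_mul_eq_mul_div]
      gcongr
      nlinarith
    rw [div_sub_one hm0.ne', norm_div, Real.norm_of_nonneg hm0.le, Real.norm_eq_abs,
      Real.norm_of_nonneg (by positivity), div_le_iff₀ hm0]
    calc _ ≤ 256 * (1 + (Real.log N / L) ^ 2) / N * (growthFactor L N * C) := hb
      _ ≤ 256 * ((1 + 4 / L ^ 2) * t ^ 2) / N * (growthFactor L N * C) := by gcongr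
      _ = 256 * C / c * L * (1 + 4 / L ^ 2) * (t ^ 2 / Real.log n) * (growthFactor L N * c) := by
        rw [hN]
        field_simp
      _ ≤ _ := by gcongr
  exact ⟨key.mono fun n h => h.1.ne', IsBigO.of_bound _ (key.mono fun n h => h.2)⟩

end MISSearch

theorem theorem1 (p : unitInterval) (hp0 : 0 < p) (hp1 : p < 1) (q : ℝ) (hq : q = 1 - (p : ℝ)) :
    (∀ u : ℝ, Summable (MISSearch.termG q u)) ∧
    (∀ u : ℝ, 0 < MISSearch.periodicG q u) ∧
    (∃ B : ℝ, ∀ u : ℝ, |MISSearch.periodicG q u| ≤ B) ∧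
    (∀ u : ℝ, MISSearch.periodicG q (u + 1) = MISSearch.periodicG q u) ∧
    ∃ ε : ℕ → ℝ,
      (ε =O[Filter.atTop] fun n : ℕ => Real.log (Real.log n) ^ 2 / Real.log n) ∧
      ∀ᶠ n : ℕ in Filter.atTop, ∀ pick : MISSearch.BranchingRule (Fin n),
        MISSearch.expectedCost p n pick = MISSearch.mainTerm q n * (1 + ε n) := by
  have hp0' : (0 : ℝ) < p := hp0
  have hp1' : (p : ℝ) < 1 := hp1
  have hq0 : 0 < q := by linarith
  have hq1 : q < 1 := by linarith
  obtain ⟨c, hc0, hc⟩ := MISSearch.exists_le_periodicG hq0 hq1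
  refine ⟨MISSearch.summable_termG hq0 hq1, fun u => hc0.trans_le (hc u),
    MISSearch.exists_abs_periodicG_le hq0 hq1, MISSearch.periodicG_add_one q,
    -- This error does not involve `pick`, which gives uniformity over the rules.
    fun n => MISSearch.meanCost q n / MISSearch.mainTerm q n - 1, ?_⟩
  have hqL : q = Real.exp (-(-Real.log q)) := by rw [neg_neg, Real.exp_log hq0]
  have h := MISSearch.isBigO_meanCost (L := -Real.log q) (by linarith [Real.log_neg hq0 hq1])
  rw [← hqL] at h
  refine ⟨h.2, h.1.mono fun n hn pick => ?_⟩
  have hμ := MISSearch.isCostSequence_meanCost (p := (p : ℝ)) (q := q) (by linarith)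
  rw [MISSearch.expectedCost_eq p (μ := MISSearch.meanCost q) (hq ▸ hμ), add_sub_cancel,
    mul_div_cancel₀ _ hn]
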